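/- A network (weighted digraph) is a pair $G=(V,\omega)$ of a finite set $V$ and a function $\omega\colon V\times V\to[0,\infty]$; the pairs with $\omega(x,y)<\infty$ are its edges. Let $d(x,y)$ be the infimum of $\sum_{i<m}\omega(x_i,x_{i+1})$ over all finite vertex sequences $x=x_0,\dots,x_m=y$ (so $d(x,x)=0$). For $\delta\in[0,\infty]$ the Dowker complex $\mathfrak D_\delta(G)$ is the simplicial complex on $V$ whose simplices are the nonempty $\sigma\subseteq V$ for which there is $y\in V$ with $d(x,y)\le\delta$ for all $x\in\sigma$. Let $\tilde H_n$ denote reduced simplicial homology with coefficients in a field (for instance $\mathbb R$). The inclusions $\mathfrak D_\delta(G)\subseteq\mathfrak D_{\delta'}(G)$ for $\delta\le\delta'$ make $\delta\mapsto\tilde H_n(\mathfrak D_\delta(G))$ a persistence module. The underlying graph of $G$ is the simple graph on $V$ in which distinct $x,y$ are adjacent iff $\omega(x,y)<\infty$ or $\omega(y,x)<\infty$. $G$ is a directed cactus graph if its underlying graph is connected and any two distinct cycles of it have at most one vertex in common. Its cycle subgraphs are the networks $C_1,\dots,C_k$ formed by the cycles of the underlying graph, with the directed edges and weights of $G$ along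 those cycles and no other edges. Theorem. Let $G$ be a directed cactus graph with cycle subgraphs $C_1,\dots,C_k$, and let $n\ge 0$. Let $\Delta_n=[0,\infty]$ if $n\ge1$, and let $\Delta_0$ be the set of $\delta\in[0,\infty]$ such that $\min(\omega(x,y),\omega(y,x))\le\delta$ for every bridge $xy$ of the underlying graph (an edge that lies on no cycle). Then for every $\delta\in\Delta_n$ $$\tilde H_n(\mathfrak D_\delta(G))\;\cong\;\bigoplus_{i=1}^k\tilde H_n(\mathfrak D_\delta(C_i)),$$ and these isomorphisms can be chosen to commute, for all $\delta\le\delta'$ in $\Delta_n$, with the maps induced by inclusions. That is, over $\Delta_n$ the persistence module of $G$ is the direct sum of the persistence modules of its cycles. -/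

import Mathlib

open scoped ENNReal DirectSum

noncomputable section

/-! ### Reduced simplicial homology with coefficients in a field -/

namespace SimplicialHomology

section Subquotient

variable {k M : Type*} [Field k] [AddCommGroup M] [Module k M]

/-- The quotient `Z / B` for subspaces `B ⊆ Z` of a vector space (in general `Z / (Z ∩ B)`). -/
def Subquotient (Z B : Submodule k M) : Type _ := Z ⧸ B.submoduleOf Z

instance (Z B : Submodule k M) : AddCommGroup (Subquotient Z B) :=
  inferInstanceAs (AddCommGroup (Z ⧸ B.submoduleOf Z))

instance (Z B : Submodule k M) : Module k (Subquotient Z B) :=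
  inferInstanceAs (Module k (Z ⧸ B.submoduleOf Z))

/-- The map `Z / B → Z' / B'` induced by inclusions `Z ⊆ Z'` and `B ⊆ B'`. -/
def Subquotient.map {Z Z' B B' : Submodule k M} (hZ : Z ≤ Z') (hB : B ≤ B') :
    Subquotient Z B →ₗ[k] Subquotient Z' B' :=
  Submodule.mapQ (B.submoduleOf Z) (B'.submoduleOf Z') (Submodule.inclusion hZ) fun _ hx => hB hx

end Subquotient

variable (k : Type*) [Field k] {V : Type*} [LinearOrder V]

/-- The oriented simplicial boundary on formal combinations of finite vertex sets, every set being
oriented by the total order of `V`: if `σ = {v₀ < ⋯ < vₘ}` then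
`∂ σ = ∑ i, (-1) ^ i • (σ \ {vᵢ})`. The exponent is the number of vertices of `σ` below the deleted
one. A one-point set is sent to the empty set, which is the augmentation of reduced homology. -/
def boundary (V : Type*) [LinearOrder V] : (Finset V →₀ k) →ₗ[k] (Finset V →₀ k) :=
  Finsupp.linearCombination k fun σ : Finset V =>
    ∑ v ∈ σ, Finsupp.single (σ.erase v) ((-1 : k) ^ (σ.filter (· < v)).card)

/-- The `n`-chains of `K`: formal combinations of faces with `n + 1` vertices. -/
def chains {V : Type*} (K : PreAbstractSimplicialComplex V) (n : ℕ) :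
    Submodule k (Finset V →₀ k) :=
  Finsupp.supported k k {σ : Finset V | σ ∈ K ∧ σ.card = n + 1}

/-- The reduced `n`-cycles of `K`. -/
def cycles (K : PreAbstractSimplicialComplex V) (n : ℕ) : Submodule k (Finset V →₀ k) :=
  chains k K n ⊓ LinearMap.ker (boundary k V)

/-- The `n`-boundaries of `K`. -/
def boundaries (K : PreAbstractSimplicialComplex V) (n : ℕ) : Submodule k (Finset V →₀ k) :=
  (chains k K (n + 1)).map (boundary k V)

/-- The reduced homology `H̃ₙ(K; k)`: cycles modulo boundaries. -/
abbrev ReducedHomology (K : PreAbstractSimplicialComplex V) (n : ℕ) : Type _ :=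
  Subquotient (cycles k K n) (boundaries k K n)

theorem chains_mono {V : Type*} {K L : PreAbstractSimplicialComplex V} (h : K ≤ L) (n : ℕ) :
    chains k K n ≤ chains k L n :=
  Finsupp.supported_mono fun _ hσ => ⟨h hσ.1, hσ.2⟩

theorem cycles_mono {K L : PreAbstractSimplicialComplex V} (h : K ≤ L) (n : ℕ) :
    cycles k K n ≤ cycles k L n :=
  inf_le_inf_right _ (chains_mono k h n)

/-- The map `H̃ₙ(K) → H̃ₙ(L)` induced by an inclusion `K ⊆ L` of complexes. -/
def homologyMap {K L : PreAbstractSimplicialComplex V} (h : K ≤ L) (n : ℕ) :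
    ReducedHomology k K n →ₗ[k] ReducedHomology k L n :=
  Subquotient.map (cycles_mono k h n) (Submodule.map_mono (chains_mono k h (n + 1)))

end SimplicialHomology

/-- The Dowker source complex of a relation `R`: a nonempty finite set `σ` is a simplex iff there is
some `y` with `R x y` for every `x ∈ σ`. -/
def dowkerComplex {X Y : Type*} (R : X → Y → Prop) : PreAbstractSimplicialComplex X where
  faces := {σ | σ.Nonempty ∧ ∃ y, ∀ x ∈ σ, R x y}
  isRelLowerSet_faces := fun _ hσ =>
    ⟨hσ.1, fun _ hτσ hτ => ⟨hτ, hσ.2.imp fun _ hy x hx => hy x (hτσ hx)⟩⟩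

/-- A network (weighted digraph) on the vertex set `V`, with weights in `[0, ∞]`. There is an edge
from `x` to `y` iff `weight x y < ∞`. -/
structure Network (V : Type*) where
  weight : V → V → ℝ≥0∞

namespace Network

variable {V : Type*} (G : Network V)

/-- The shortest path function: the infimum of the weights of all finite vertex sequences
`p 0 = x, p 1, …, p m = y`; the constant sequence (`m = 0`) has weight `0`. -/
def dist (x y : V) : ℝ≥0∞ :=
  ⨅ (m : ℕ) (p : Fin (m + 1) → V) (_ : p 0 = x) (_ : p (Fin.last m) = y),
    ∑ i : Fin m, G.weight (p i.castSucc) (p i.succ)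

/-- The path completion of a network. -/
def pathCompletion : Network V := ⟨G.dist⟩

/-- The relation "the weight from `x` to `y` is at most `δ`". -/
def rel (δ : ℝ≥0∞) (x y : V) : Prop := G.weight x y ≤ δ

/-- The Dowker filtration of `G`: the Dowker complexes of the path completion. -/
def dowker (δ : ℝ≥0∞) : PreAbstractSimplicialComplex V :=
  dowkerComplex (G.pathCompletion.rel δ)

theorem dowker_mono {δ δ' : ℝ≥0∞} (h : δ ≤ δ') : G.dowker δ ≤ G.dowker δ' :=
  fun _ hσ => ⟨hσ.1, hσ.2.imp fun _ hy x hx => (hy x hx).trans h⟩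

/-- The vector space at `δ` of the `n`-th (reduced) Dowker persistence module of `G`. -/
abbrev PersistentHomology (k : Type*) [Field k] [LinearOrder V] (n : ℕ) (δ : ℝ≥0∞) : Type _ :=
  SimplicialHomology.ReducedHomology k (G.dowker δ) n

/-- The structure maps of the `n`-th Dowker persistence module of `G`, induced by inclusions. -/
def persistenceMap (k : Type*) [Field k] [LinearOrder V] (n : ℕ) {δ δ' : ℝ≥0∞} (h : δ ≤ δ') :
    G.PersistentHomology k n δ →ₗ[k] G.PersistentHomology k n δ' :=
  SimplicialHomology.homologyMap k (G.dowker_mono h) n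

/-- The underlying undirected simple graph: two distinct vertices are adjacent iff there is an edge
between them in at least one direction. -/
def underlying : SimpleGraph V where
  Adj x y := x ≠ y ∧ (G.weight x y < ∞ ∨ G.weight y x < ∞)
  symm := ⟨fun _ _ h => ⟨h.1.symm, h.2.symm⟩⟩
  loopless := ⟨fun _ h => h.1 rfl⟩

open Classical in
/-- The weighted digraph carried by a subgraph `H` of the underlying graph: its vertices are those
of `H`, and its edges are the directed edges of `G` along `H`, with their weights in `G`. -/
def restrict (H : G.underlying.Subgraph) : Network H.verts :=
  ⟨fun x y => if H.Adj x y then G.weight x y else ∞⟩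

/-- The cycle subgraphs of `G`, edge orientations being ignored. -/
def cycleSubgraphs : Set G.underlying.Subgraph :=
  {H | ∃ (v : V) (p : G.underlying.Walk v v), p.IsCycle ∧ p.toSubgraph = H}

/-- A directed cactus graph: the underlying graph is connected, and any two distinct cycles in it
share at most one vertex. -/
structure IsDirectedCactus : Prop where
  connected : G.underlying.Connected
  subsingleton_inter : ∀ C ∈ G.cycleSubgraphs, ∀ C' ∈ G.cycleSubgraphs, C ≠ C' →
    (C.verts ∩ C'.verts).Subsingleton

/-- Every edge of `G` that lies on no cycle (every bridge of the underlying graph) has weight at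
most `δ` in some direction. -/
def BridgesWithin (δ : ℝ≥0∞) : Prop :=
  ∀ x y, G.underlying.Adj x y → G.underlying.IsBridge s(x, y) →
    min (G.weight x y) (G.weight y x) ≤ δ

end Network

end

/-! A cactus grows from a single vertex by gluing on, one at a time, a cycle or a bridge `B` along
one vertex `x`. Two facts make each step behave like a wedge. First, such a `B` is gated: deleting
its edges disconnects its vertices from each other. Hence the graph retracts onto `B`, every edge
being collapsed or lying in `B`, and distances do not grow. Moving a witness `y` to its retract
shows that the Dowker complex of `B` alone is the one that `G` induces on the vertices of `B`
(`map_mem_dowker_iff`). Second, if a simplex has vertices strictly on both sides of `x`, then from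
one of them every path to the witness runs through `x`, so `x` can be adjoined
(`insert_mem_dowker`).

Coning from `x` removes the mixed simplices and leaves two complexes that meet in a point, so
reduced homology splits (`exists_cycles_of_wedge`, `mem_boundaries_of_wedge`). A bridge contributes
nothing: in positive degree always, in degree 0 once it is present at scale `δ`. Gluing until all
vertices are reached (`exists_extension`) shows that the map from the sum over the cycles is
bijective. It is induced by inclusions, so it commutes with the structure maps. -/

noncomputable section

/-! ### Cones, and the reduced homology of a wedge -/

namespace SimplicialHomology

variable (k : Type*) [Field k] {V : Type*} [LinearOrder V]

/-- The cone operator with apex `x`: the oriented join of a simplex with the vertex `x`, which is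
zero on the simplices that contain `x`. -/
def cone (x : V) : (Finset V →₀ k) →ₗ[k] (Finset V →₀ k) :=
  Finsupp.linearCombination k fun σ : Finset V =>
    if x ∈ σ then 0 else Finsupp.single (insert x σ) ((-1 : k) ^ (σ.filter (· < x)).card)

variable {k}

theorem boundary_single (σ : Finset V) (a : k) :
    boundary k V (Finsupp.single σ a) =
      a • ∑ v ∈ σ, Finsupp.single (σ.erase v) ((-1 : k) ^ (σ.filter (· < v)).card) := by
  simp [boundary]

theorem cone_single (x : V) (σ : Finset V) (a : k) :
    cone k x (Finsupp.single σ a) =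
      if x ∈ σ then 0 else
        Finsupp.single (insert x σ) (a * (-1 : k) ^ (σ.filter (· < x)).card) := by
  simp only [cone, Finsupp.linearCombination_single]
  split_ifs <;> simp

theorem neg_one_pow_mul_self (m : ℕ) : (-1 : k) ^ m * (-1) ^ m = 1 := by
  rw [← mul_pow]; simp

theorem filter_erase_lt (σ : Finset V) (v x : V) :
    (σ.erase v).filter (· < x) = (σ.filter (· < x)).erase v := by
  ext a; simp [and_assoc]

/-- The cone operator is a contracting homotopy of the augmented chain complex of all finite
subsets. -/
theorem boundary_cone_add_cone_boundary (x : V) (w : Finset V →₀ k) :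
    boundary k V (cone k x w) + cone k x (boundary k V w) = w := by
  induction w using Finsupp.induction_linear with
  | zero => simp
  | add f g hf hg =>
    simp only [map_add]
    rw [add_add_add_comm, hf, hg]
  | single σ a =>
    rw [cone_single, boundary_single, map_smul, map_sum]
    by_cases hx : x ∈ σ
    · rw [if_pos hx, map_zero, zero_add, Finset.sum_eq_single_of_mem x hx]
      · rw [cone_single, if_neg (by simp), Finset.insert_erase hx, filter_erase_lt,
          Finset.erase_eq_of_notMem (s := σ.filter (· < x)) (by simp), neg_one_pow_mul_self]
        simp
      · intro v _ hvx
        rw [cone_single, if_pos (by simp [hx, hvx.symm])]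
    · rw [if_neg hx, boundary_single, Finset.sum_insert hx, Finset.erase_insert hx,
        Finset.filter_insert, if_neg (lt_irrefl x), smul_add, add_assoc, Finset.smul_sum,
        Finset.smul_sum, ← Finset.sum_add_distrib, Finset.sum_eq_zero, add_zero]
      · rw [Finsupp.smul_single, smul_eq_mul, mul_assoc, neg_one_pow_mul_self, mul_one]
      · intro v hv
        have hvx : v ≠ x := fun h => hx (h ▸ hv)
        rw [cone_single, if_neg (by simp [hx]), Finset.erase_insert_of_ne hvx.symm,
          Finsupp.smul_single, Finsupp.smul_single, ← Finsupp.single_add, Finset.filter_insert]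
        refine (congrArg _ ?_).trans (Finsupp.single_zero _)
        -- Exactly one exponent shifts by one: deleting `v < x` lowers the count below `x`, and
        -- adding `x < v` raises the count below `v`. So the two terms cancel.
        rcases lt_or_gt_of_ne hvx with h | h
        · rw [if_neg h.le.not_gt, filter_erase_lt,
            ← Finset.card_erase_add_one (s := σ.filter (· < x)) (a := v) (by simp [hv, h])]
          simp only [smul_eq_mul, pow_succ]
          ring
        · rw [if_pos h, Finset.card_insert_of_notMem (by simp [hx]), filter_erase_lt,
            Finset.erase_eq_of_notMem (s := σ.filter (· < x)) (by simp [h.le])]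
          simp only [smul_eq_mul, pow_succ]
          ring

/-- Up to sign a nonempty simplex is a cone over a smaller one, and the homotopy identity, used
twice, passes the claim down to the base of the cone. -/
theorem boundary_boundary (w : Finset V →₀ k) : boundary k V (boundary k V w) = 0 := by
  induction w using Finsupp.induction_linear with
  | zero => simp
  | add f g hf hg => simp [hf, hg]
  | single σ a =>
    induction σ using Finset.induction_on generalizing a with
    | empty => simp [boundary_single]
    | insert x σ hx ih =>
      have h : Finsupp.single (insert x σ) a =
          cone k x (Finsupp.single σ (a * (-1 : k) ^ (σ.filter (· < x)).card)) := by
        rw [cone_single, if_neg hx, mul_assoc, neg_one_pow_mul_self, mul_one]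
      have hc (w : Finset V →₀ k) :
          boundary k V (cone k x w) = w - cone k x (boundary k V w) :=
        eq_sub_of_add_eq (boundary_cone_add_cone_boundary x w)
      rw [h, hc, map_sub, hc, ih]
      simp

theorem map_mem_supported {α β : Type*} (f : (α →₀ k) →ₗ[k] (β →₀ k)) {s : Set α} {t : Set β}
    (h : ∀ a ∈ s, f (Finsupp.single a 1) ∈ Finsupp.supported k k t) {w : α →₀ k}
    (hw : w ∈ Finsupp.supported k k s) : f w ∈ Finsupp.supported k k t := by
  rw [Finsupp.supported_eq_span_single] at hw
  have : Submodule.span k ((fun i => Finsupp.single i (1 : k)) '' s) ≤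
      (Finsupp.supported k k t).comap f := by
    rw [Submodule.span_le]
    rintro _ ⟨a, ha, rfl⟩
    exact h a ha
  exact this hw

theorem boundary_mem_supported {s t : Set (Finset V)} (h : ∀ σ ∈ s, ∀ v ∈ σ, σ.erase v ∈ t)
    {w : Finset V →₀ k} (hw : w ∈ Finsupp.supported k k s) :
    boundary k V w ∈ Finsupp.supported k k t := by
  refine map_mem_supported _ (fun σ hσ => ?_) hw
  rw [boundary_single, one_smul]
  exact Submodule.sum_mem _ fun v hv => Finsupp.single_mem_supported k _ (h σ hσ v hv)

theorem cone_mem_supported {x : V} {s t : Set (Finset V)} (h : ∀ σ ∈ s, x ∉ σ → insert x σ ∈ t)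
    {w : Finset V →₀ k} (hw : w ∈ Finsupp.supported k k s) :
    cone k x w ∈ Finsupp.supported k k t := by
  refine map_mem_supported _ (fun σ hσ => ?_) hw
  rw [cone_single]
  split_ifs with hx
  · exact zero_mem _
  · exact Finsupp.single_mem_supported k _ (h σ hσ hx)

/-- The subcomplex of `K` induced on the vertex set `S`. -/
def induced {V : Type*} (K : PreAbstractSimplicialComplex V) (S : Set V) :
    PreAbstractSimplicialComplex V where
  faces := {σ | σ ∈ K ∧ (σ : Set V) ⊆ S}
  isRelLowerSet_faces := fun _ hσ => ⟨(K.isRelLowerSet_faces hσ.1).1, fun _ hτσ hτ =>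
    ⟨(K.isRelLowerSet_faces hσ.1).2 hτσ hτ, (Finset.coe_subset.2 hτσ).trans hσ.2⟩⟩

theorem induced_mono {V : Type*} (K : PreAbstractSimplicialComplex V) {S T : Set V} (h : S ⊆ T) :
    induced K S ≤ induced K T := fun _ hσ => ⟨hσ.1, hσ.2.trans h⟩

theorem induced_univ {V : Type*} (K : PreAbstractSimplicialComplex V) :
    induced K Set.univ = K := by
  ext σ
  exact ⟨fun h => h.1, fun h => ⟨h, Set.subset_univ _⟩⟩

theorem boundaries_mono {K L : PreAbstractSimplicialComplex V} (h : K ≤ L) (n : ℕ) :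
    boundaries k K n ≤ boundaries k L n :=
  Submodule.map_mono (chains_mono k h (n + 1))

theorem boundary_mem_chains {K : PreAbstractSimplicialComplex V} {n : ℕ} {w : Finset V →₀ k}
    (hw : w ∈ chains k K (n + 1)) : boundary k V w ∈ chains k K n := by
  refine boundary_mem_supported ?_ hw
  rintro σ ⟨hσ, hc⟩ v hv
  have hc' : (σ.erase v).card = n + 1 := by rw [Finset.card_erase_of_mem hv, hc]; simp
  exact ⟨(K.isRelLowerSet_faces hσ).2 (σ.erase_subset v)
    (Finset.card_pos.1 (by omega)), hc'⟩

/-- If adjoining `x` to any `n`-simplex gives a simplex, then all `n`-cycles are boundaries. -/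
theorem cycles_le_boundaries_of_cone {K : PreAbstractSimplicialComplex V} {n : ℕ} (x : V)
    (h : ∀ σ ∈ K, σ.card = n + 1 → insert x σ ∈ K) : cycles k K n ≤ boundaries k K n := by
  rintro z ⟨hz, hz0⟩
  refine ⟨cone k x z, cone_mem_supported ?_ hz, ?_⟩
  · rintro σ ⟨hσ, hc⟩ hx
    exact ⟨h σ hσ hc, by rw [Finset.card_insert_of_notMem hx, hc]⟩
  · have := boundary_cone_add_cone_boundary x z
    rwa [LinearMap.mem_ker.1 hz0, map_zero, add_zero] at this

section Wedge

variable {K : PreAbstractSimplicialComplex V} {A B : Set V} {x : V}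

/-- The augmented chain complex of a point is acyclic. Here `n` counts vertices, so `n = 0` allows
the empty face; this is what makes the splitting hold in degree 0 too. -/
theorem boundary_cone_of_subset_singleton (hx : {x} ∈ K) {S : Set V} (hS : x ∈ S) {n : ℕ}
    {u : Finset V →₀ k}
    (hu : u ∈ Finsupp.supported k k {σ : Finset V | (σ : Set V) ⊆ {x} ∧ σ.card = n})
    (hu0 : boundary k V u = 0) :
    cone k x u ∈ chains k (induced K S) n ∧ boundary k V (cone k x u) = u := by
  constructor
  · refine cone_mem_supported ?_ hu
    rintro σ ⟨hσ, hc⟩ hxσ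
    have h0 : σ = ∅ := Finset.eq_empty_of_forall_notMem fun v hv => hxσ (by
      have := hσ hv
      rwa [← Set.mem_singleton_iff.1 this])
    subst h0
    exact ⟨⟨by simpa using hx, by simpa using hS⟩, by rw [← hc]; simp⟩
  · have := boundary_cone_add_cone_boundary x u
    rwa [hu0, map_zero, add_zero] at this

theorem mem_supported_inter {α : Type*} {s t : Set α} {u : α →₀ k}
    (hs : u ∈ Finsupp.supported k k s) (ht : u ∈ Finsupp.supported k k t) :
    u ∈ Finsupp.supported k k (s ∩ t) := by
  rw [Finsupp.supported_inter]; exact ⟨hs, ht⟩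

theorem boundary_mem_supported_of_mem_chains_induced {S : Set V} {n : ℕ} {w : Finset V →₀ k}
    (hw : w ∈ chains k (induced K S) n) :
    boundary k V w ∈ Finsupp.supported k k {σ : Finset V | (σ : Set V) ⊆ S ∧ σ.card = n} := by
  refine boundary_mem_supported ?_ hw
  rintro σ ⟨hσ, hc⟩ v hv
  exact ⟨fun a ha => hσ.2 (Finset.mem_of_mem_erase ha), by
    rw [Finset.card_erase_of_mem hv, hc]; simp⟩

theorem exists_add_of_mem_chains_sup {V : Type*} {L M : PreAbstractSimplicialComplex V} {n : ℕ}
    {w : Finset V →₀ k} (hw : w ∈ chains k (L ⊔ M) n) :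
    ∃ a ∈ chains k L n, ∃ b ∈ chains k M n, a + b = w := by
  have h : chains k (L ⊔ M) n ≤ chains k L n ⊔ chains k M n := by
    rw [chains, chains, chains, ← Finsupp.supported_union]
    refine Finsupp.supported_mono ?_
    rintro σ ⟨hσ | hσ, hc⟩
    · exact Or.inl ⟨hσ, hc⟩
    · exact Or.inr ⟨hσ, hc⟩
  exact Submodule.mem_sup.1 (h hw)

/-- Chains whose boundary does not meet the mixed simplices can be moved off the mixed
simplices. -/
theorem sub_boundary_cone_mem_chains_sup
    (hmix : ∀ σ ∈ K, (σ : Set V) ⊆ A ∪ B → ¬ (σ : Set V) ⊆ A → ¬ (σ : Set V) ⊆ B →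
      insert x σ ∈ K) (hA : x ∈ A) (hB : x ∈ B) {n : ℕ} {w : Finset V →₀ k}
    (hw : w ∈ chains k (induced K (A ∪ B)) n)
    (hbd : boundary k V w ∈
      Finsupp.supported k k {σ : Finset V | (σ : Set V) ⊆ A ∨ (σ : Set V) ⊆ B}) :
    ∃ c ∈ chains k (induced K (A ∪ B)) (n + 1),
      w - boundary k V c ∈ chains k (induced K A ⊔ induced K B) n := by
  -- `P` holds the unmixed simplices; `l` and `m` are the unmixed and mixed parts of `w`. The
  -- correction is the cone over `m`.
  set P : Set (Finset V) := {σ | (σ : Set V) ⊆ A ∨ (σ : Set V) ⊆ B} with hP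
  obtain ⟨l, hl, m, hm, rfl⟩ : ∃ l ∈ Finsupp.supported k k
        ({σ : Finset V | σ ∈ induced K (A ∪ B) ∧ σ.card = n + 1} ∩ P),
      ∃ m ∈ Finsupp.supported k k
        ({σ : Finset V | σ ∈ induced K (A ∪ B) ∧ σ.card = n + 1} \ P), l + m = w := by
    have : chains k (induced K (A ∪ B)) n ≤ _ := le_of_eq (by
      rw [chains, ← Set.inter_union_sdiff {σ : Finset V | σ ∈ induced K (A ∪ B) ∧ σ.card = n + 1} P,
        Finsupp.supported_union])
    exact Submodule.mem_sup.1 (this hw)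
  have hcm : cone k x m ∈ chains k (induced K (A ∪ B)) (n + 1) := by
    refine cone_mem_supported ?_ hm
    rintro σ ⟨⟨hσ, hc⟩, hσP⟩ hx
    rw [hP, Set.mem_ofPred_eq, not_or] at hσP
    refine ⟨⟨hmix σ hσ.1 hσ.2 hσP.1 hσP.2, ?_⟩, by rw [Finset.card_insert_of_notMem hx, hc]⟩
    rw [Finset.coe_insert]
    exact Set.insert_subset (Or.inl hA) hσ.2
  refine ⟨_, hcm, ?_⟩
  have hlP : l ∈ Finsupp.supported k k P := Finsupp.supported_mono Set.inter_subset_right hl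
  have hm0 : boundary k V m ∈ Finsupp.supported k k P := by
    have h1 : boundary k V l ∈ Finsupp.supported k k P := by
      refine boundary_mem_supported ?_ hlP
      rintro σ hσ v _
      exact hσ.imp (fun h a ha => h (Finset.mem_of_mem_erase ha))
        (fun h a ha => h (Finset.mem_of_mem_erase ha))
    have := Submodule.sub_mem _ hbd h1
    rwa [map_add, add_sub_cancel_left] at this
  -- By the homotopy identity `m` is replaced by the cone over its boundary. That boundary is
  -- unmixed, and coning from `x ∈ A ∩ B` keeps it so.
  have hP' : l + m - boundary k V (cone k x m) ∈ Finsupp.supported k k P := by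
    have h2 : l + m - boundary k V (cone k x m) = l + cone k x (boundary k V m) := by
      rw [add_sub_assoc, add_right_inj, sub_eq_iff_eq_add, add_comm,
        boundary_cone_add_cone_boundary]
    rw [h2]
    refine Submodule.add_mem _ hlP (cone_mem_supported ?_ hm0)
    rintro σ hσ _
    refine hσ.imp (fun h => ?_) (fun h => ?_) <;> rw [Finset.coe_insert]
    exacts [Set.insert_subset hA h, Set.insert_subset hB h]
  have hK : l + m - boundary k V (cone k x m) ∈ chains k (induced K (A ∪ B)) n :=
    Submodule.sub_mem _ hw (boundary_mem_chains hcm)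
  refine Finsupp.supported_mono ?_ (mem_supported_inter hK hP')
  rintro σ ⟨⟨hσ, hc⟩, h | h⟩
  · exact ⟨Or.inl ⟨hσ.1, h⟩, hc⟩
  · exact ⟨Or.inr ⟨hσ.1, h⟩, hc⟩

theorem chains_sup_le_supported {V : Type*} {K : PreAbstractSimplicialComplex V} {A B : Set V}
    {n : ℕ} : chains k (induced K A ⊔ induced K B) n ≤
    Finsupp.supported k k {σ : Finset V | (σ : Set V) ⊆ A ∨ (σ : Set V) ⊆ B} := by
  refine Finsupp.supported_mono ?_
  rintro σ ⟨hσ | hσ, _⟩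
  exacts [Or.inl hσ.2, Or.inr hσ.2]

/-- Reduced homology of a wedge, surjectivity: a cycle of the wedge is homologous to a sum of
cycles of its two parts. -/
theorem exists_cycles_of_wedge (hx : {x} ∈ K) (hAB : A ∩ B = {x})
    (hmix : ∀ σ ∈ K, (σ : Set V) ⊆ A ∪ B → ¬ (σ : Set V) ⊆ A → ¬ (σ : Set V) ⊆ B →
      insert x σ ∈ K) {n : ℕ} {z : Finset V →₀ k} (hz : z ∈ cycles k (induced K (A ∪ B)) n) :
    ∃ a ∈ cycles k (induced K A) n, ∃ b ∈ cycles k (induced K B) n,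
      z - (a + b) ∈ boundaries k (induced K (A ∪ B)) n := by
  have hxAB : x ∈ A ∩ B := hAB ▸ rfl
  have hz0 : boundary k V z = 0 := hz.2
  obtain ⟨c, hc, hzc⟩ := sub_boundary_cone_mem_chains_sup hmix hxAB.1 hxAB.2 hz.1
    (by rw [hz0]; exact zero_mem _)
  obtain ⟨a, ha, b, hb, hab⟩ := exists_add_of_mem_chains_sup hzc
  have hbd : boundary k V a = - boundary k V b := by
    rw [eq_neg_iff_add_eq_zero, ← map_add, hab, map_sub, hz0, boundary_boundary, sub_zero]
  -- The common boundary of `a` and `-b` lives on both sides, hence on `{x}`, where it can be filled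
  -- to turn both chains into cycles.
  have hu : boundary k V a ∈
      Finsupp.supported k k {σ : Finset V | (σ : Set V) ⊆ {x} ∧ σ.card = n} := by
    have h1 := boundary_mem_supported_of_mem_chains_induced ha
    have h2 := boundary_mem_supported_of_mem_chains_induced hb
    rw [← Submodule.neg_mem_iff, ← hbd] at h2
    refine Finsupp.supported_mono ?_ (mem_supported_inter h1 h2)
    rintro σ ⟨hσ, hσ'⟩
    exact ⟨hAB ▸ Set.subset_inter hσ.1 hσ'.1, hσ.2⟩
  obtain ⟨hcA, hcu⟩ := boundary_cone_of_subset_singleton hx hxAB.1 hu (boundary_boundary a)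
  obtain ⟨hcB, -⟩ := boundary_cone_of_subset_singleton hx hxAB.2 hu (boundary_boundary a)
  refine ⟨a - cone k x (boundary k V a), ⟨Submodule.sub_mem _ ha hcA, ?_⟩,
    b + cone k x (boundary k V a), ⟨Submodule.add_mem _ hb hcB, ?_⟩, c, hc, ?_⟩
  · rw [SetLike.mem_coe, LinearMap.mem_ker, map_sub, hcu, sub_self]
  · rw [SetLike.mem_coe, LinearMap.mem_ker, map_add, hcu, hbd, add_neg_cancel]
  · rw [sub_add_add_cancel, hab, sub_sub_cancel]

/-- Reduced homology of a wedge, injectivity: if a sum of cycles of the two parts bounds in the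
wedge, then each of them bounds in its part. -/
theorem mem_boundaries_of_wedge (hx : {x} ∈ K) (hAB : A ∩ B = {x})
    (hmix : ∀ σ ∈ K, (σ : Set V) ⊆ A ∪ B → ¬ (σ : Set V) ⊆ A → ¬ (σ : Set V) ⊆ B →
      insert x σ ∈ K) {n : ℕ} {a b : Finset V →₀ k} (ha : a ∈ cycles k (induced K A) n)
    (hb : b ∈ cycles k (induced K B) n) (hab : a + b ∈ boundaries k (induced K (A ∪ B)) n) :
    a ∈ boundaries k (induced K A) n ∧ b ∈ boundaries k (induced K B) n := by
  have hxAB : x ∈ A ∩ B := hAB ▸ rfl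
  obtain ⟨w, hw, hwab⟩ := hab
  have hbd : boundary k V w ∈
      Finsupp.supported k k {σ : Finset V | (σ : Set V) ⊆ A ∨ (σ : Set V) ⊆ B} := by
    rw [hwab]
    exact chains_sup_le_supported (n := n) (Submodule.add_mem _
      (chains_mono k le_sup_left n ha.1) (chains_mono k le_sup_right n hb.1))
  obtain ⟨c, hc, hwc⟩ := sub_boundary_cone_mem_chains_sup hmix hxAB.1 hxAB.2 hw hbd
  obtain ⟨p, hp, q, hq, hpq⟩ := exists_add_of_mem_chains_sup hwc
  have hsum : boundary k V p + boundary k V q = a + b := by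
    rw [← map_add, hpq, map_sub, boundary_boundary, sub_zero, hwab]
  have heq : a - boundary k V p = -(b - boundary k V q) := by
    rw [neg_sub, sub_eq_sub_iff_add_eq_add, ← hsum, add_comm]
  -- The error of `p` as a filling of `a` is minus that of `q` for `b`, so it lives on `{x}` and
  -- bounds on either side.
  have hu : a - boundary k V p ∈
      Finsupp.supported k k {σ : Finset V | (σ : Set V) ⊆ {x} ∧ σ.card = n + 1} := by
    have h1 := Submodule.sub_mem _ ha.1 (boundary_mem_chains hp)
    have h2 := Submodule.sub_mem _ hb.1 (boundary_mem_chains hq)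
    rw [← Submodule.neg_mem_iff, ← heq] at h2
    refine Finsupp.supported_mono ?_ (mem_supported_inter h1 h2)
    rintro σ ⟨hσ, hσ'⟩
    exact ⟨hAB ▸ Set.subset_inter hσ.1.2 hσ'.1.2, hσ.2⟩
  have hu0 : boundary k V (a - boundary k V p) = 0 := by
    rw [map_sub, boundary_boundary, sub_zero]; exact ha.2
  obtain ⟨hcA, hcu⟩ := boundary_cone_of_subset_singleton hx hxAB.1 hu hu0
  obtain ⟨hcB, -⟩ := boundary_cone_of_subset_singleton hx hxAB.2 hu hu0
  refine ⟨⟨p + cone k x (a - boundary k V p), Submodule.add_mem _ hp hcA, ?_⟩,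
    ⟨q - cone k x (a - boundary k V p), Submodule.sub_mem _ hq hcB, ?_⟩⟩
  · rw [map_add, hcu, add_sub_cancel]
  · rw [map_sub, hcu, heq, sub_neg_eq_add, add_sub_cancel]

end Wedge

end SimplicialHomology

/-! ### Gated subgraphs and retractions -/

namespace SimpleGraph

variable {V : Type*} {G : SimpleGraph V}

/-- A function that is constant along the edges of a connected subgraph is constant on it. -/
theorem Subgraph.Connected.eq_of_forall_adj {α : Type*} {H : G.Subgraph} (hH : H.Connected)
    {f : V → α} (hf : ∀ u v, H.Adj u v → f u = f v) {u v : V} (hu : u ∈ H.verts)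
    (hv : v ∈ H.verts) : f u = f v := by
  obtain ⟨p⟩ := hH.coe ⟨u, hu⟩ ⟨v, hv⟩
  suffices ∀ {a b : H.verts}, H.coe.Walk a b → f a = f b from this p
  intro a b p
  induction p with
  | nil => rfl
  | cons h _ ih => exact (hf _ _ h).trans ih

/-- A connected subgraph `B` is gated if distinct vertices of `B` become disconnected when the
edges of `B` are deleted. -/
structure Subgraph.IsGated (B : G.Subgraph) : Prop where
  connected : B.Connected
  eq_of_reachable : ∀ a ∈ B.verts, ∀ b ∈ B.verts, (G \ B.spanningCoe).Reachable a b → a = b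

/-- Each component of `G` minus the edges of `B` meets `B`, as a walk towards `B` shows, and by
gatedness only once. That vertex is the retract of the component. -/
theorem Subgraph.IsGated.exists_retraction {B : G.Subgraph} (hB : B.IsGated)
    (hG : G.Connected) :
    ∃ r : V → V, (∀ v, r v ∈ B.verts) ∧ (∀ v ∈ B.verts, r v = v) ∧
      ∀ u v, G.Adj u v → r u = r v ∨ B.Adj u v := by
  obtain ⟨b, hb⟩ := hB.connected.nonempty
  have hex : ∀ y, ∃ c ∈ B.verts, (G \ B.spanningCoe).Reachable c y := by
    intro y
    obtain ⟨p⟩ := hG y b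
    induction p with
    | nil => exact ⟨_, hb, Reachable.refl _⟩
    | @cons y w _ h _ ih =>
      obtain ⟨c, hc, hcw⟩ := ih hb
      by_cases hyw : B.Adj y w
      · exact ⟨y, hyw.fst_mem, Reachable.refl _⟩
      · refine ⟨c, hc, hcw.trans (Adj.reachable ?_).symm⟩
        exact ⟨h, hyw⟩
  choose r hr hreach using hex
  refine ⟨r, hr, fun v hv => hB.eq_of_reachable _ (hr v) _ hv (hreach v), fun u v huv => ?_⟩
  by_cases h : B.Adj u v
  · exact Or.inr h
  · refine Or.inl (hB.eq_of_reachable _ (hr u) _ (hr v) ((hreach u).trans ?_))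
    have huv' : (G \ B.spanningCoe).Adj u v := ⟨huv, h⟩
    exact huv'.reachable.trans (hreach v).symm

/-- A walk that ends in `S` contains a path to its first vertex in `S`. -/
theorem Walk.exists_isPath_support_inter {G' : SimpleGraph V} {S : Set V} {u v : V}
    (p : G'.Walk u v) (hv : v ∈ S) :
    ∃ c ∈ S, ∃ q : G'.Walk u c, q.IsPath ∧ q.support ⊆ p.support ∧
      ∀ a ∈ q.support, a ∈ S → a = c := by
  classical
  induction p with
  | nil => exact ⟨_, hv, Walk.nil, by simp, by simp, by simp⟩
  | @cons u w _ h p ih =>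
    obtain ⟨c, hc, q, -, hsub, hq⟩ := ih hv
    by_cases hu : u ∈ S
    · exact ⟨u, hu, Walk.nil, by simp, by simp, by simp⟩
    · refine ⟨c, hc, (Walk.cons h q).bypass, Walk.bypass_isPath _,
        List.Subset.trans (Walk.support_bypass_subset_support _) ?_, fun a ha haS => ?_⟩
      · rw [Walk.support_cons, Walk.support_cons]
        exact List.cons_subset_cons _ hsub
      · have := Walk.support_bypass_subset_support _ ha
        rw [Walk.support_cons, List.mem_cons] at this
        rcases this with rfl | h'
        · exact absurd haS hu
        · exact hq a h' haS

theorem Subgraph.Connected.exists_isPath {H : G.Subgraph} (hH : H.Connected) {u v : V}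
    (hu : u ∈ H.verts) (hv : v ∈ H.verts) :
    ∃ p : G.Walk u v, p.IsPath ∧ (∀ a ∈ p.support, a ∈ H.verts) ∧
      ∀ a b, s(a, b) ∈ p.edges → H.Adj a b := by
  classical
  suffices ∀ u v : H.verts, ∃ p : G.Walk (H.hom u) (H.hom v), p.IsPath ∧
      (∀ a ∈ p.support, a ∈ H.verts) ∧ ∀ a b, s(a, b) ∈ p.edges → H.Adj a b from
    this ⟨u, hu⟩ ⟨v, hv⟩
  intro u v
  obtain ⟨p, hp⟩ := (hH.coe u v).exists_isPath
  refine ⟨p.map H.hom, hp.map Subtype.val_injective, ?_, ?_⟩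
  · intro a ha
    rw [Walk.support_map, List.mem_map] at ha
    obtain ⟨b, -, rfl⟩ := ha
    exact b.2
  · intro a b hab
    rw [Walk.edges_map, List.mem_map] at hab
    obtain ⟨e, he, hab⟩ := hab
    induction e with
    | h c d =>
      have hcd : H.Adj c d := p.adj_of_mem_edges he
      rcases Sym2.eq_iff.1 hab with ⟨rfl, rfl⟩ | ⟨rfl, rfl⟩
      exacts [hcd, hcd.symm]

/-- If any two distinct cycles share at most one vertex, then cycles are gated. -/
theorem Walk.isGated_toSubgraph {v : V} {p : G.Walk v v}
    (h : ∀ (w : V) (q : G.Walk w w), q.IsCycle → q.toSubgraph ≠ p.toSubgraph →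
      (q.toSubgraph.verts ∩ p.toSubgraph.verts).Subsingleton) :
    p.toSubgraph.IsGated := by
  classical
  refine ⟨p.toSubgraph_connected, fun a ha b hb hab => ?_⟩
  by_contra hne
  obtain ⟨q, hq⟩ := hab.exists_isPath
  cases q with
  | nil => exact hne rfl
  | @cons _ w _ haw q =>
    rw [Walk.cons_isPath_iff] at hq
    -- A path from `a` avoiding the edges of the cycle first returns to it at `c`. Closed up by a
    -- path inside the cycle, it forms a second cycle through both `a` and `c`, distinct because it
    -- uses the edge `aw`.
    obtain ⟨c, hc, s, hs, hsq, hsc⟩ := q.exists_isPath_support_inter hb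
    have hac : a ≠ c := by
      rintro rfl
      exact hq.2 (hsq s.end_mem_support)
    obtain ⟨t, ht, htv, hte⟩ := p.toSubgraph_connected.exists_isPath hc ha
    have hle : G \ p.toSubgraph.spanningCoe ≤ G := sdiff_le
    have hs' : (s.mapLe hle).IsPath := (Walk.isPath_mapLe hle).2 hs
    have hpath : ((s.mapLe hle).append t).IsPath := by
      rw [Walk.isPath_def, Walk.support_append, List.nodup_append']
      refine ⟨hs'.support_nodup, ht.support_nodup.tail, ?_⟩
      intro d hd hdt
      have hdc := hsc d (by simpa using hd) (htv d (List.mem_of_mem_tail hdt))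
      subst hdc
      have := ht.support_nodup
      rw [← Walk.cons_tail_support, List.nodup_cons] at this
      exact this.1 hdt
    have hnot : ¬ p.toSubgraph.Adj a w := haw.2
    have hcyc : (Walk.cons haw.1 ((s.mapLe hle).append t)).IsCycle := by
      rw [Walk.cons_isCycle_iff]
      refine ⟨hpath, fun he => ?_⟩
      rw [Walk.edges_append, List.mem_append] at he
      rcases he with he | he
      · have := Walk.fst_mem_support_of_mem_edges _ he
        exact hac (hsc a (by simpa using this) ha)
      · exact hnot (hte _ _ he)
    refine hac (h a _ hcyc ?_ ⟨?_, ha⟩ ⟨?_, hc⟩)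
    · intro heq
      apply hnot
      rw [← heq]
      simp
    · simp
    · simp

theorem IsBridge.isGated_subgraphOfAdj {x y : V} (h : G.Adj x y) (hb : G.IsBridge s(x, y)) :
    (G.subgraphOfAdj h).IsGated := by
  have hsd : G \ (G.subgraphOfAdj h).spanningCoe = G.deleteEdges {s(x, y)} := by
    ext a b
    simp only [sdiff_adj, Subgraph.spanningCoe_adj, subgraphOfAdj_adj, deleteEdges_adj,
      Set.mem_singleton_iff]
    rw [eq_comm]
  refine ⟨Subgraph.subgraphOfAdj_connected h, ?_⟩
  rw [hsd]
  rintro a (rfl | rfl) b (rfl | rfl) hab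
  · rfl
  · exact absurd hab (isBridge_iff.1 hb)
  · exact absurd hab.symm (isBridge_iff.1 hb)
  · rfl

end SimpleGraph

/-! ### Distances and Dowker complexes under gluing -/

namespace Network

variable {V : Type*} (G : Network V)

/-- A potential that drops along each edge by at most its weight bounds distances from below, by
telescoping. The lower bounds on distances below come from a choice of `F`. -/
theorem le_dist {F : V → ℝ≥0∞} {y : V} (hy : F y = 0) (h : ∀ u v, F u ≤ G.weight u v + F v)
    (x : V) : F x ≤ G.dist x y := by
  have key : ∀ (m : ℕ) (p : Fin (m + 1) → V),
      F (p 0) ≤ (∑ i : Fin m, G.weight (p i.castSucc) (p i.succ)) + F (p (Fin.last m)) := by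
    intro m
    induction m with
    | zero => intro p; simp
    | succ m ih =>
      intro p
      rw [Fin.sum_univ_succ]
      refine (h (p 0) (p 1)).trans ((add_le_add le_rfl (ih fun i => p i.succ)).trans ?_)
      exact (add_assoc _ _ _).ge
  refine le_iInf fun m => le_iInf fun p => le_iInf fun h0 => le_iInf fun h1 => ?_
  have := key m p
  rwa [h0, h1, hy, add_zero] at this

@[simp]
theorem dist_self (x : V) : G.dist x x = 0 := by
  refine le_antisymm ?_ zero_le
  refine iInf_le_of_le 0 (iInf_le_of_le (fun _ => x) (iInf_le_of_le rfl (iInf_le_of_le rfl ?_)))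
  simp

theorem dist_le_weight_add (u v y : V) : G.dist u y ≤ G.weight u v + G.dist v y := by
  rw [← tsub_le_iff_left]
  refine le_iInf fun m => le_iInf fun p => le_iInf fun h0 => le_iInf fun h1 => ?_
  rw [tsub_le_iff_left]
  refine iInf_le_of_le (m + 1) (iInf_le_of_le (Fin.cons u p) (iInf_le_of_le (by simp)
    (iInf_le_of_le (by rw [← Fin.succ_last, Fin.cons_succ, h1]) ?_)))
  rw [Fin.sum_univ_succ]
  simp [h0]

theorem dist_le_weight (x y : V) : G.dist x y ≤ G.weight x y := by
  simpa using G.dist_le_weight_add x y y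

theorem adj_underlying_of_weight_ne_top {u v : V} (huv : u ≠ v) (h : G.weight u v ≠ ∞) :
    G.underlying.Adj u v := ⟨huv, Or.inl h.lt_top⟩

/-- If every edge that leaves `P` has `x` as an endpoint, then the paths from `P` to its complement
pass through `x`. -/
theorem dist_le_of_cut {P : V → Prop} {x b y : V}
    (hcut : ∀ u v, G.underlying.Adj u v → P u → ¬ P v → u = x ∨ v = x) (hb : P b) (hy : ¬ P y) :
    G.dist x y ≤ G.dist b y := by
  classical
  have := G.le_dist (F := fun u => if P u then G.dist x y else G.dist u y) (y := y)
    (by simp [hy]) (fun u v => ?_) b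
  · simpa [hb] using this
  by_cases huv : u = v
  · subst huv; exact le_add_self
  by_cases hw : G.weight u v = ∞
  · simp [hw]
  have hadj := G.adj_underlying_of_weight_ne_top huv hw
  split_ifs with hu hv hv
  · exact le_add_self
  · rcases hcut u v hadj hu hv with rfl | rfl
    · exact G.dist_le_weight_add _ _ _
    · exact le_add_self
  · rcases hcut v u hadj.symm hv hu with rfl | rfl
    · exact G.dist_le_weight_add _ _ _
    · exact le_add_self
  · exact G.dist_le_weight_add _ _ _

theorem mem_dowker {δ : ℝ≥0∞} {σ : Finset V} :
    σ ∈ G.dowker δ ↔ σ.Nonempty ∧ ∃ y, ∀ x ∈ σ, G.dist x y ≤ δ := Iff.rfl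

theorem singleton_mem_dowker (δ : ℝ≥0∞) (x : V) : {x} ∈ G.dowker δ :=
  ⟨by simp, x, by simp [rel, pathCompletion]⟩

variable {G}

theorem dist_le_dist_restrict (H : G.underlying.Subgraph) (x y : H.verts) :
    G.dist x y ≤ (G.restrict H).dist x y := by
  refine (G.restrict H).le_dist (F := fun u => G.dist u y) (by simp) (fun u v => ?_) x
  simp only [restrict]
  split_ifs
  · exact G.dist_le_weight_add _ _ _
  · simp

/-- The simplices of the Dowker complex of a gated subgraph are those of the whole network. -/
theorem map_mem_dowker_iff (hG : G.underlying.Connected) {B : G.underlying.Subgraph}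
    (hB : B.IsGated) (δ : ℝ≥0∞) (σ : Finset B.verts) :
    σ.map (Function.Embedding.subtype _) ∈ G.dowker δ ↔ σ ∈ (G.restrict B).dowker δ := by
  rw [mem_dowker, mem_dowker, Finset.map_nonempty]
  refine and_congr_right fun _ => ⟨?_, ?_⟩
  · rintro ⟨y, hy⟩
    obtain ⟨r, hr, hrB, hadj⟩ := hB.exists_retraction hG
    refine ⟨⟨r y, hr y⟩, fun x hx => ?_⟩
    refine le_trans ?_ (hy x (by simpa using hx))
    -- The potential is the distance in `B` between retracts: it is constant along collapsed edges,
    -- and the other edges lie in `B` with their own weights.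
    have := G.le_dist (F := fun u => (G.restrict B).dist ⟨r u, hr u⟩ ⟨r y, hr y⟩) (y := y)
      (by simp) (fun u v => ?_) x
    · simpa only [hrB x x.2] using this
    by_cases huv : u = v
    · subst huv; exact le_add_self
    by_cases hw : G.weight u v = ∞
    · simp [hw]
    rcases hadj u v (G.adj_underlying_of_weight_ne_top huv hw) with h | h
    · simp only [h]; exact le_add_self
    · have h1 := (G.restrict B).dist_le_weight_add ⟨u, h.fst_mem⟩ ⟨v, h.snd_mem⟩ ⟨r y, hr y⟩
      simp only [hrB u h.fst_mem, hrB v h.snd_mem]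
      refine h1.trans (le_of_eq ?_)
      simp [restrict, h]
  · rintro ⟨y, hy⟩
    refine ⟨y, fun x hx => ?_⟩
    obtain ⟨x', hx', rfl⟩ := Finset.mem_map.1 hx
    exact (dist_le_dist_restrict B x' y).trans (hy x' hx')

section Glue

variable {H B : G.underlying.Subgraph} {x : V}

/-- A retraction onto a gated subgraph collapses a connected subgraph that meets it in one
vertex. -/
theorem retraction_eq_of_inter_eq_singleton (hH : H.Connected) (hx : H.verts ∩ B.verts = {x})
    {r : V → V} (hrB : ∀ v ∈ B.verts, r v = v)
    (hadj : ∀ u v, G.underlying.Adj u v → r u = r v ∨ B.Adj u v) {u : V} (hu : u ∈ H.verts) :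
    r u = x := by
  have hxHB : x ∈ H.verts ∩ B.verts := hx ▸ rfl
  rw [← hrB x hxHB.2]
  refine hH.eq_of_forall_adj (fun u v huv => ?_) hu hxHB.1
  refine (hadj u v huv.adj_sub).resolve_right fun h => huv.ne ?_
  have h1 : u ∈ H.verts ∩ B.verts := ⟨huv.fst_mem, h.fst_mem⟩
  have h2 : v ∈ H.verts ∩ B.verts := ⟨huv.snd_mem, h.snd_mem⟩
  rw [hx] at h1 h2
  exact h1.trans h2.symm

/-- The gluing vertex can be adjoined to every simplex that meets both parts. -/
theorem insert_mem_dowker (hG : G.underlying.Connected) (hH : H.Connected) (hB : B.IsGated)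
    (hx : H.verts ∩ B.verts = {x}) {δ : ℝ≥0∞} {σ : Finset V} [DecidableEq V]
    (hσ : σ ∈ G.dowker δ) (hHB : (σ : Set V) ⊆ H.verts ∪ B.verts) (hσH : ¬ (σ : Set V) ⊆ H.verts)
    (hσB : ¬ (σ : Set V) ⊆ B.verts) : insert x σ ∈ G.dowker δ := by
  have hxHB : x ∈ H.verts ∩ B.verts := hx ▸ rfl
  obtain ⟨r, -, hrB, hadj⟩ := hB.exists_retraction hG
  obtain ⟨a, ha, haH⟩ := Set.not_subset.1 hσH
  obtain ⟨b, hb, hbB⟩ := Set.not_subset.1 hσB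
  have haB : a ∈ B.verts := (hHB ha).resolve_left haH
  have hrb : r b = x :=
    retraction_eq_of_inter_eq_singleton hH hx hrB hadj ((hHB hb).resolve_right hbB)
  have hra : r a ≠ x := by
    rw [hrB a haB]; rintro rfl; exact haH hxHB.1
  -- The fibre of `r` over `x` can be left only from `x` itself. It contains `b` but not `a`, so `x`
  -- separates `y` from one of them.
  have hcut : ∀ u v, G.underlying.Adj u v → r u = x → r v ≠ x → u = x := by
    intro u v huv hu hv
    rcases hadj u v huv with h | h
    · exact absurd (h.symm.trans hu) hv
    · rw [← hrB u h.fst_mem, hu]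
  obtain ⟨hne, y, hy⟩ := G.mem_dowker.1 hσ
  refine G.mem_dowker.2 ⟨by simp, y, ?_⟩
  have hxy : G.dist x y ≤ δ := by
    by_cases hry : r y = x
    · refine (G.dist_le_of_cut (P := fun u => r u ≠ x) (fun u v huv hu hv => ?_) hra
        (not_not.2 hry)).trans (hy a ha)
      exact Or.inr (hcut v u huv.symm (not_not.1 hv) hu)
    · refine (G.dist_le_of_cut (P := fun u => r u = x) (fun u v huv hu hv => ?_) hrb
        hry).trans (hy b hb)
      exact Or.inl (hcut u v huv hu hv)
  intro c hc
  rcases Finset.mem_insert.1 hc with rfl | hc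
  exacts [hxy, hy c hc]

/-- The retraction onto `B` is constant on `C`, sends `H` to `x` and fixes `B`. So if `C` meets both
parts, it meets `B` in `x`, which lies in `H` as well. -/
theorem subsingleton_inter_union (hG : G.underlying.Connected) (hH : H.Connected)
    (hB : B.IsGated) (hx : H.verts ∩ B.verts = {x}) {C : G.underlying.Subgraph}
    (hC : C.Connected) (hCH : (C.verts ∩ H.verts).Subsingleton)
    (hCB : (C.verts ∩ B.verts).Subsingleton) :
    (C.verts ∩ (H.verts ∪ B.verts)).Subsingleton := by
  have hxHB : x ∈ H.verts ∩ B.verts := hx ▸ rfl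
  obtain ⟨r, -, hrB, hadj⟩ := hB.exists_retraction hG
  have key : ∀ p ∈ C.verts, ∀ q ∈ C.verts, p ∈ H.verts → q ∈ B.verts → p = q := by
    intro p hpC q hqC hp hq
    have hpq : r p = r q := by
      refine hC.eq_of_forall_adj (fun u v huv => ?_) hpC hqC
      refine (hadj u v huv.adj_sub).resolve_right fun h => huv.ne ?_
      exact hCB ⟨huv.fst_mem, h.fst_mem⟩ ⟨huv.snd_mem, h.snd_mem⟩
    rw [retraction_eq_of_inter_eq_singleton hH hx hrB hadj hp, hrB q hq] at hpq
    exact hCH ⟨hpC, hp⟩ ⟨hqC, hpq ▸ hxHB.1⟩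
  rintro p ⟨hpC, hp | hp⟩ q ⟨hqC, hq | hq⟩
  · exact hCH ⟨hpC, hp⟩ ⟨hqC, hq⟩
  · exact key p hpC q hqC hp hq
  · exact (key q hqC p hpC hq hp).symm
  · exact hCB ⟨hpC, hp⟩ ⟨hqC, hq⟩

end Glue

theorem connected_of_mem_cycleSubgraphs {C : G.underlying.Subgraph} (hC : C ∈ G.cycleSubgraphs) :
    C.Connected := by
  obtain ⟨v, p, -, rfl⟩ := hC
  exact p.toSubgraph_connected

theorem nontrivial_of_mem_cycleSubgraphs {C : G.underlying.Subgraph}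
    (hC : C ∈ G.cycleSubgraphs) : C.verts.Nontrivial := by
  obtain ⟨v, p, hp, rfl⟩ := hC
  cases p with
  | nil => exact absurd hp SimpleGraph.Walk.not_isCycle_nil
  | @cons _ w _ h q => exact ⟨v, by simp, w, by simp, h.ne⟩

theorem IsDirectedCactus.isGated (hG : G.IsDirectedCactus) {C : G.underlying.Subgraph}
    (hC : C ∈ G.cycleSubgraphs) : C.IsGated := by
  have hC' := hC
  obtain ⟨v, p, hp, rfl⟩ := hC
  exact SimpleGraph.Walk.isGated_toSubgraph fun w q hq hne =>
    hG.subsingleton_inter _ ⟨w, q, hq, rfl⟩ _ hC' hne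

/-! ### Growing the decomposition by bridges and cycles -/

open SimplicialHomology

/-- The homology of the Dowker complex induced on the vertices of the connected subgraph `H` is the
direct sum of those of the cycles in the family `T`, which consists of all cycles that share more
than one vertex with `H`. -/
structure IsDecomposedBy (k : Type*) [Field k] [LinearOrder V] (n : ℕ) (δ : ℝ≥0∞)
    (H : G.underlying.Subgraph) (T : Finset G.underlying.Subgraph) : Prop where
  connected : H.Connected
  mem_cycleSubgraphs : ∀ C ∈ T, C ∈ G.cycleSubgraphs
  subset : ∀ C ∈ T, C.verts ⊆ H.verts
  subsingleton : ∀ C ∈ G.cycleSubgraphs, C ∉ T → (C.verts ∩ H.verts).Subsingleton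
  exists_sum : ∀ z ∈ cycles k (induced (G.dowker δ) H.verts) n,
    ∃ f : G.underlying.Subgraph → Finset V →₀ k,
      (∀ C ∈ T, f C ∈ cycles k (induced (G.dowker δ) C.verts) n) ∧
        z - ∑ C ∈ T, f C ∈ boundaries k (induced (G.dowker δ) H.verts) n
  mem_boundaries : ∀ f : G.underlying.Subgraph → Finset V →₀ k,
    (∀ C ∈ T, f C ∈ cycles k (induced (G.dowker δ) C.verts) n) →
      ∑ C ∈ T, f C ∈ boundaries k (induced (G.dowker δ) H.verts) n →
        ∀ C ∈ T, f C ∈ boundaries k (induced (G.dowker δ) C.verts) n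

namespace IsDecomposedBy

variable {k : Type*} [Field k] [LinearOrder V] {n : ℕ} {δ : ℝ≥0∞}
  {H : G.underlying.Subgraph} {T : Finset G.underlying.Subgraph} {B : G.underlying.Subgraph} {x : V}

theorem singletonSubgraph (v : V) :
    IsDecomposedBy k n δ (G.underlying.singletonSubgraph v) ∅ where
  connected := SimpleGraph.Subgraph.singletonSubgraph_connected
  mem_cycleSubgraphs := by simp
  subset := by simp
  subsingleton := fun C _ _ => Set.subsingleton_singleton.anti Set.inter_subset_right
  exists_sum := fun z hz => by
    refine ⟨0, by simp, ?_⟩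
    rw [Finset.sum_empty, sub_zero]
    refine cycles_le_boundaries_of_cone v (fun σ hσ _ => ?_) hz
    obtain ⟨a, ha⟩ := ((G.dowker δ).isRelLowerSet_faces hσ.1).1
    have hav : a = v := hσ.2 ha
    rwa [Finset.insert_eq_of_mem (hav ▸ ha)]
  mem_boundaries := by simp

theorem sum_mem_cycles (h : IsDecomposedBy k n δ H T) {f : G.underlying.Subgraph → Finset V →₀ k}
    (hf : ∀ C ∈ T, f C ∈ cycles k (induced (G.dowker δ) C.verts) n) :
    ∑ C ∈ T, f C ∈ cycles k (induced (G.dowker δ) H.verts) n :=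
  Submodule.sum_mem _ fun C hC => cycles_mono k (induced_mono _ (h.subset C hC)) n (hf C hC)

/-- Gluing a bridge to `H` does not change the homology. -/
theorem sup_of_acyclic (hG : G.underlying.Connected) (h : IsDecomposedBy k n δ H T)
    (hB : B.IsGated) (hx : H.verts ∩ B.verts = {x})
    (hCB : ∀ C ∈ G.cycleSubgraphs, (C.verts ∩ B.verts).Subsingleton)
    (hacyc : cycles k (induced (G.dowker δ) B.verts) n ≤
      boundaries k (induced (G.dowker δ) B.verts) n) :
    IsDecomposedBy k n δ (H ⊔ B) T where
  connected := SimpleGraph.Subgraph.connected_sup h.connected.preconnected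
    hB.connected.preconnected ⟨x, by
    rw [SimpleGraph.Subgraph.verts_inf, hx]; rfl⟩
  mem_cycleSubgraphs := h.mem_cycleSubgraphs
  subset := fun C hC => (h.subset C hC).trans Set.subset_union_left
  subsingleton := fun C hC hCT => subsingleton_inter_union hG h.connected hB hx
    (connected_of_mem_cycleSubgraphs hC) (h.subsingleton C hC hCT) (hCB C hC)
  exists_sum := fun z hz => by
    rw [SimpleGraph.Subgraph.verts_sup] at hz ⊢
    obtain ⟨a, ha, b, hb, hab⟩ := exists_cycles_of_wedge (G.singleton_mem_dowker δ x) hx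
      (fun σ hσ => insert_mem_dowker hG h.connected hB hx hσ) hz
    obtain ⟨f, hf, haf⟩ := h.exists_sum a ha
    refine ⟨f, hf, ?_⟩
    have := Submodule.add_mem _ (Submodule.add_mem _ hab
      (boundaries_mono (induced_mono _ Set.subset_union_left) n haf))
      (boundaries_mono (induced_mono _ Set.subset_union_right) n (hacyc hb))
    convert this using 1
    abel
  mem_boundaries := fun f hf hsum => by
    rw [SimpleGraph.Subgraph.verts_sup] at hsum
    refine h.mem_boundaries f hf (mem_boundaries_of_wedge (G.singleton_mem_dowker δ x) hx
      (fun σ hσ => insert_mem_dowker hG h.connected hB hx hσ) (h.sum_mem_cycles hf)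
      (zero_mem _) ?_).1
    rwa [add_zero]

open Classical in
/-- Gluing a cycle to `H` adds a direct summand. -/
theorem sup_of_cycle (hG : G.IsDirectedCactus) (h : IsDecomposedBy k n δ H T)
    (hB : B ∈ G.cycleSubgraphs) (hBT : B ∉ T) (hx : H.verts ∩ B.verts = {x}) :
    IsDecomposedBy k n δ (H ⊔ B) (insert B T) where
  connected := SimpleGraph.Subgraph.connected_sup h.connected.preconnected
    (hG.isGated hB).connected.preconnected ⟨x, by
    rw [SimpleGraph.Subgraph.verts_inf, hx]; rfl⟩
  mem_cycleSubgraphs := fun C hC => by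
    rcases Finset.mem_insert.1 hC with rfl | hC
    exacts [hB, h.mem_cycleSubgraphs C hC]
  subset := fun C hC => by
    rw [SimpleGraph.Subgraph.verts_sup]
    rcases Finset.mem_insert.1 hC with rfl | hC
    · exact Set.subset_union_right
    · exact (h.subset C hC).trans Set.subset_union_left
  subsingleton := fun C hC hCT => by
    rw [Finset.mem_insert, not_or] at hCT
    exact subsingleton_inter_union hG.connected h.connected (hG.isGated hB) hx
      (connected_of_mem_cycleSubgraphs hC) (h.subsingleton C hC hCT.2)
      (hG.subsingleton_inter C hC B hB hCT.1)
  exists_sum := fun z hz => by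
    rw [SimpleGraph.Subgraph.verts_sup] at hz ⊢
    obtain ⟨a, ha, b, hb, hab⟩ := exists_cycles_of_wedge (G.singleton_mem_dowker δ x) hx
      (fun σ hσ => insert_mem_dowker hG.connected h.connected (hG.isGated hB) hx hσ) hz
    obtain ⟨f, hf, haf⟩ := h.exists_sum a ha
    have hne : ∀ C ∈ T, C ≠ B := fun C hC hCB => hBT (hCB ▸ hC)
    refine ⟨Function.update f B b, fun C hC => ?_, ?_⟩
    · rcases Finset.mem_insert.1 hC with rfl | hC
      · rwa [Function.update_self]
      · rw [Function.update_of_ne (hne C hC)]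
        exact hf C hC
    · rw [Finset.sum_insert hBT, Function.update_self,
        Finset.sum_congr rfl fun C hC => Function.update_of_ne (hne C hC) b f]
      have := Submodule.add_mem _ hab
        (boundaries_mono (induced_mono _ Set.subset_union_left) n haf)
      convert this using 1
      abel
  mem_boundaries := fun f hf hsum => by
    rw [SimpleGraph.Subgraph.verts_sup, Finset.sum_insert hBT, add_comm] at hsum
    have hf' : ∀ C ∈ T, f C ∈ cycles k (induced (G.dowker δ) C.verts) n :=
      fun C hC => hf C (Finset.mem_insert_of_mem hC)
    obtain ⟨h1, h2⟩ := mem_boundaries_of_wedge (G.singleton_mem_dowker δ x) hx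
      (fun σ hσ => insert_mem_dowker hG.connected h.connected (hG.isGated hB) hx hσ)
      (h.sum_mem_cycles hf') (hf B (Finset.mem_insert_self _ _)) hsum
    intro C hC
    rcases Finset.mem_insert.1 hC with rfl | hC
    · exact h2
    · exact h.mem_boundaries f hf' h1 C hC

end IsDecomposedBy

/-- An edge that is present at scale `δ`, or any edge in positive degree, is acyclic. -/
theorem cycles_le_boundaries_of_pair {k : Type*} [Field k] [LinearOrder V] {n : ℕ} {δ : ℝ≥0∞}
    {x y : V} (h : n = 0 → min (G.weight x y) (G.weight y x) ≤ δ) :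
    cycles k (induced (G.dowker δ) {x, y}) n ≤ boundaries k (induced (G.dowker δ) {x, y}) n := by
  refine cycles_le_boundaries_of_cone x fun σ hσ hc => ?_
  by_cases hxσ : x ∈ σ
  · rwa [Finset.insert_eq_of_mem hxσ]
  -- Only the simplex `{y}` misses `x`, so the weight bound matters in degree 0 alone.
  have hσy : σ ⊆ {y} := fun a ha => by
    rcases hσ.2 ha with rfl | h
    exacts [absurd ha hxσ, by simpa using h]
  have hn : n = 0 := by
    have := Finset.card_le_card hσy
    rw [Finset.card_singleton] at this
    omega
  have hσ' : σ = {y} := Finset.eq_of_subset_of_card_le hσy (by simp [hc])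
  subst hσ'
  refine ⟨G.mem_dowker.2 ⟨by simp, ?_⟩, by simp⟩
  rcases min_le_iff.1 (h hn) with h | h
  · exact ⟨y, by simpa using (G.dist_le_weight x y).trans h⟩
  · exact ⟨x, by simpa using (G.dist_le_weight y x).trans h⟩

/-- As long as `H` does not contain all vertices, the decomposition can be extended. -/
theorem IsDecomposedBy.exists_extension {k : Type*} [Field k] [LinearOrder V] {n : ℕ} {δ : ℝ≥0∞}
    (hG : G.IsDirectedCactus) (hδ : n = 0 → G.BridgesWithin δ) {H : G.underlying.Subgraph}
    {T : Finset G.underlying.Subgraph} (h : IsDecomposedBy k n δ H T) (hH : H.verts ≠ Set.univ) :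
    ∃ (H' : G.underlying.Subgraph) (T' : Finset G.underlying.Subgraph),
      IsDecomposedBy k n δ H' T' ∧ H.verts ⊂ H'.verts := by
  classical
  obtain ⟨b, hb⟩ := (Set.ne_univ_iff_exists_notMem _).1 hH
  obtain ⟨a, ha⟩ := h.connected.nonempty
  obtain ⟨p⟩ := hG.connected a b
  -- An edge `xy` leaving `H` is either a bridge or on a cycle; that bridge or cycle is glued on at
  -- `x`.
  obtain ⟨d, -, hx, hy⟩ := p.exists_boundary_dart H.verts ha hb
  obtain ⟨⟨x, y⟩, hxy⟩ := d
  change x ∈ H.verts at hx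
  change y ∉ H.verts at hy
  change G.underlying.Adj x y at hxy
  by_cases hbr : G.underlying.IsBridge s(x, y)
  · refine ⟨H ⊔ G.underlying.subgraphOfAdj hxy, T,
      h.sup_of_acyclic (x := x) hG.connected (hbr.isGated_subgraphOfAdj hxy) ?_ ?_
        (cycles_le_boundaries_of_pair fun hn => hδ hn x y hxy hbr), ?_⟩
    · ext c
      constructor
      · rintro ⟨hc, rfl | rfl⟩
        exacts [rfl, absurd hc hy]
      · rintro rfl
        exact ⟨hx, Or.inl rfl⟩
    · intro C hC
      have key : ¬ (x ∈ C.verts ∧ y ∈ C.verts) := by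
        rintro ⟨hxC, hyC⟩
        -- Gatedness rules out chords: an edge between two vertices of a cycle belongs to it, which
        -- a bridge cannot.
        have hadj : C.Adj x y := by
          by_contra hnot
          have hxy' : (G.underlying \ C.spanningCoe).Adj x y := ⟨hxy, hnot⟩
          exact hxy.ne ((hG.isGated hC).eq_of_reachable x hxC y hyC hxy'.reachable)
        obtain ⟨v, q, hq, rfl⟩ := hC
        exact hbr.notMem_edges_of_isCycle hq
          (SimpleGraph.Walk.adj_toSubgraph_iff_mem_edges.1 hadj)
      rintro c ⟨hc, rfl | rfl⟩ c' ⟨hc', rfl | rfl⟩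
      exacts [rfl, absurd ⟨hc, hc'⟩ key, absurd ⟨hc', hc⟩ key, rfl]
    · refine Set.ssubset_iff_exists.2 ⟨Set.subset_union_left, y, Or.inr ?_, hy⟩
      exact Or.inr rfl
  · rw [SimpleGraph.isBridge_iff_forall_cycle_notMem hxy] at hbr
    push Not at hbr
    obtain ⟨v, q, hq, hqe⟩ := hbr
    have hC : q.toSubgraph ∈ G.cycleSubgraphs := ⟨v, q, hq, rfl⟩
    have hadj : q.toSubgraph.Adj x y := SimpleGraph.Walk.adj_toSubgraph_iff_mem_edges.2 hqe
    -- The cycle contains `y ∉ H`, so it is new, and by the invariant `subsingleton` it meets `H`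
    -- only in `x`.
    have hCT : q.toSubgraph ∉ T := fun hT => hy (h.subset _ hT hadj.snd_mem)
    refine ⟨H ⊔ q.toSubgraph, insert q.toSubgraph T,
      h.sup_of_cycle (x := x) hG hC hCT ?_, ?_⟩
    · ext c
      constructor
      · rintro ⟨hc, hc'⟩
        exact h.subsingleton _ hC hCT ⟨hc', hc⟩ ⟨hadj.fst_mem, hx⟩
      · rintro rfl
        exact ⟨hx, hadj.fst_mem⟩
    · exact Set.ssubset_iff_exists.2 ⟨Set.subset_union_left, y, Or.inr hadj.snd_mem, hy⟩

/-- The homology of a cactus is decomposed by the family of all its cycles. -/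
theorem IsDirectedCactus.exists_isDecomposedBy (k : Type*) [Field k] [Finite V] [LinearOrder V]
    (hG : G.IsDirectedCactus) {n : ℕ} {δ : ℝ≥0∞} (hδ : n = 0 → G.BridgesWithin δ) :
    ∃ (H : G.underlying.Subgraph) (T : Finset G.underlying.Subgraph),
      H.verts = Set.univ ∧ (∀ C, C ∈ T ↔ C ∈ G.cycleSubgraphs) ∧ IsDecomposedBy k n δ H T := by
  obtain ⟨v⟩ := hG.connected.nonempty
  obtain ⟨S, ⟨H, T, h, rfl⟩, hmax⟩ := (Set.toFinite
    {S : Set V | ∃ H T, IsDecomposedBy (G := G) k n δ H T ∧ H.verts = S}).exists_maximal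
    ⟨_, _, _, IsDecomposedBy.singletonSubgraph v, rfl⟩
  have hH : H.verts = Set.univ := by
    by_contra hne
    obtain ⟨H', T', h', hlt⟩ := h.exists_extension hG hδ hne
    exact hlt.not_subset (hmax ⟨H', T', h', rfl⟩ hlt.subset)
  refine ⟨H, T, hH, fun C => ⟨h.mem_cycleSubgraphs C, fun hC => ?_⟩, h⟩
  -- A cycle missing from `T` would meet `H`, now all of `V`, in at most one vertex.
  by_contra hCT
  have := h.subsingleton C hC hCT
  rw [hH, Set.inter_univ] at this
  exact Set.not_subsingleton_iff.2 (nontrivial_of_mem_cycleSubgraphs hC) this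

end Network

/-! ### Transfer of chains from a vertex subset -/

namespace SimplicialHomology

section Subquotient

variable {k M N : Type*} [Field k] [AddCommGroup M] [Module k M] [AddCommGroup N] [Module k N]

/-- The class in `Z / B` of an element of `Z`. -/
def Subquotient.mk (Z B : Submodule k M) : Z →ₗ[k] Subquotient Z B := (B.submoduleOf Z).mkQ

theorem Subquotient.mk_surjective (Z B : Submodule k M) :
    Function.Surjective (Subquotient.mk Z B) := Submodule.mkQ_surjective _

theorem Subquotient.mk_eq_zero {Z B : Submodule k M} {z : Z} :
    Subquotient.mk Z B z = 0 ↔ (z : M) ∈ B :=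
  Submodule.Quotient.mk_eq_zero (B.submoduleOf Z)

/-- The map of subquotients induced by a linear map. -/
def Subquotient.mapOfLinear (f : M →ₗ[k] N) {Z B : Submodule k M} {Z' B' : Submodule k N}
    (hZ : ∀ z ∈ Z, f z ∈ Z') (hB : ∀ z ∈ B, f z ∈ B') : Subquotient Z B →ₗ[k] Subquotient Z' B' :=
  Submodule.mapQ (B.submoduleOf Z) (B'.submoduleOf Z') (f.restrict hZ) fun z hz => hB z hz

end Subquotient

variable (k : Type*) [Field k] {V : Type*} [LinearOrder V]

/-- Extension of chains on a vertex set `S ⊆ V` to chains on `V`. -/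
def extend {V : Type*} (S : Set V) : (Finset S →₀ k) →ₗ[k] (Finset V →₀ k) :=
  Finsupp.lmapDomain k k (Finset.map (Function.Embedding.subtype (· ∈ S)))

variable {k}

theorem extend_single {V : Type*} (S : Set V) (σ : Finset S) (a : k) :
    extend k S (Finsupp.single σ a) =
      Finsupp.single (σ.map (Function.Embedding.subtype (· ∈ S))) a :=
  Finsupp.mapDomain_single

theorem extend_injective {V : Type*} (S : Set V) : Function.Injective (extend k S) :=
  Finsupp.mapDomain_injective (Finset.map_injective _)

/-- `S` carries the order of `V`, so the orientation signs agree. -/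
theorem boundary_extend (S : Set V) (w : Finset S →₀ k) :
    boundary k V (extend k S w) = extend k S (boundary k S w) := by
  induction w using Finsupp.induction_linear with
  | zero => simp
  | add f g hf hg => simp [hf, hg]
  | single σ a =>
    rw [extend_single, boundary_single, boundary_single, map_smul, map_sum, Finset.sum_map]
    congr 1
    refine Finset.sum_congr rfl fun v _ => ?_
    rw [extend_single, Finset.map_erase, Finset.filter_map, Finset.card_map]
    rfl

section Extend

variable {S : Set V} {K : PreAbstractSimplicialComplex V} {L : PreAbstractSimplicialComplex S}

theorem map_extend_chains {V : Type*} {S : Set V} {K : PreAbstractSimplicialComplex V}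
    {L : PreAbstractSimplicialComplex S}
    (h : ∀ σ : Finset S, σ.map (Function.Embedding.subtype (· ∈ S)) ∈ K ↔ σ ∈ L) (n : ℕ) :
    (chains k L n).map (extend k S) = chains k (induced K S) n := by
  rw [chains, chains, extend, Finsupp.lmapDomain_supported]
  congr 1
  ext σ
  constructor
  · rintro ⟨τ, ⟨hτ, hc⟩, rfl⟩
    refine ⟨⟨(h τ).2 hτ, fun a ha => ?_⟩, by rw [Finset.card_map, hc]⟩
    obtain ⟨b, -, rfl⟩ := Finset.mem_map.1 (Finset.mem_coe.1 ha)
    exact b.2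
  · rintro ⟨hσ, hc⟩
    obtain ⟨τ, rfl⟩ : ∃ τ : Finset S, τ.map (Function.Embedding.subtype (· ∈ S)) = σ := by
      classical
      exact ⟨σ.subtype (· ∈ S), Finset.subtype_map_of_mem fun a ha => hσ.2 ha⟩
    exact ⟨τ, ⟨(h τ).1 hσ.1, by rw [← hc, Finset.card_map]⟩, rfl⟩

theorem map_extend_cycles
    (h : ∀ σ : Finset S, σ.map (Function.Embedding.subtype (· ∈ S)) ∈ K ↔ σ ∈ L) (n : ℕ) :
    (cycles k L n).map (extend k S) = cycles k (induced K S) n := by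
  ext z
  constructor
  · rintro ⟨w, ⟨hw, hw0⟩, rfl⟩
    refine ⟨map_extend_chains (k := k) h n ▸ Submodule.mem_map_of_mem hw, ?_⟩
    rw [SetLike.mem_coe, LinearMap.mem_ker, boundary_extend, LinearMap.mem_ker.1 hw0, map_zero]
  · rintro ⟨hz, hz0⟩
    rw [SetLike.mem_coe, ← map_extend_chains h n] at hz
    obtain ⟨w, hw, rfl⟩ := hz
    refine ⟨w, ⟨hw, ?_⟩, rfl⟩
    rw [SetLike.mem_coe, LinearMap.mem_ker, boundary_extend] at hz0
    exact extend_injective S (hz0.trans (map_zero _).symm)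

theorem map_extend_boundaries
    (h : ∀ σ : Finset S, σ.map (Function.Embedding.subtype (· ∈ S)) ∈ K ↔ σ ∈ L) (n : ℕ) :
    (boundaries k L n).map (extend k S) = boundaries k (induced K S) n := by
  rw [boundaries, boundaries, ← map_extend_chains h, ← Submodule.map_comp, ← Submodule.map_comp]
  congr 1
  ext1 w
  exact LinearMap.ext fun a => (boundary_extend S _).symm

end Extend

end SimplicialHomology

/-! ### The comparison map and its naturality -/

namespace Network

open SimplicialHomology

variable {V : Type*} [LinearOrder V] {G : Network V}

theorem IsDirectedCactus.map_mem_dowker_iff {V : Type*} {G : Network V}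
    (hG : G.IsDirectedCactus) (C : G.cycleSubgraphs) (δ : ℝ≥0∞) (σ : Finset C.1.verts) :
    σ.map (Function.Embedding.subtype (· ∈ C.1.verts)) ∈ G.dowker δ ↔
      σ ∈ (G.restrict C.1).dowker δ :=
  Network.map_mem_dowker_iff hG.connected (hG.isGated C.2) δ σ

theorem IsDirectedCactus.extend_mem_cycles {k : Type*} [Field k] (hG : G.IsDirectedCactus)
    (n : ℕ) (δ : ℝ≥0∞) (C : G.cycleSubgraphs) {z : Finset C.1.verts →₀ k}
    (hz : z ∈ cycles k ((G.restrict C.1).dowker δ) n) :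
    extend k C.1.verts z ∈ cycles k (induced (G.dowker δ) C.1.verts) n :=
  map_extend_cycles (k := k) (hG.map_mem_dowker_iff C δ) n ▸ Submodule.mem_map_of_mem hz

theorem IsDirectedCactus.extend_mem_boundaries_iff {k : Type*} [Field k] (hG : G.IsDirectedCactus)
    (n : ℕ) (δ : ℝ≥0∞) (C : G.cycleSubgraphs) {z : Finset C.1.verts →₀ k} :
    extend k C.1.verts z ∈ boundaries k (induced (G.dowker δ) C.1.verts) n ↔
      z ∈ boundaries k ((G.restrict C.1).dowker δ) n := by
  rw [← map_extend_boundaries (hG.map_mem_dowker_iff C δ) n]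
  exact (extend_injective C.1.verts).mem_set_image

theorem induced_le {V : Type*} (K : PreAbstractSimplicialComplex V) (S : Set V) :
    induced K S ≤ K := fun _ h => h.1

/-- The map in persistent homology induced by the inclusion of a cycle subgraph. -/
def cycleInclusion (k : Type*) [Field k] (hG : G.IsDirectedCactus) (n : ℕ) (δ : ℝ≥0∞)
    (C : G.cycleSubgraphs) :
    (G.restrict C.1).PersistentHomology k n δ →ₗ[k] G.PersistentHomology k n δ :=
  Subquotient.mapOfLinear (extend k C.1.verts)
    (fun _ hz => cycles_mono k (induced_le _ _) n (hG.extend_mem_cycles n δ C hz))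
    (fun _ hz => boundaries_mono (induced_le _ _) n ((hG.extend_mem_boundaries_iff n δ C).2 hz))

theorem persistenceMap_cycleInclusion (k : Type*) [Field k] (hG : G.IsDirectedCactus) (n : ℕ)
    {δ δ' : ℝ≥0∞} (h : δ ≤ δ') (C : G.cycleSubgraphs)
    (x : (G.restrict C.1).PersistentHomology k n δ) :
    G.persistenceMap k n h (cycleInclusion k hG n δ C x) =
      cycleInclusion k hG n δ' C ((G.restrict C.1).persistenceMap k n h x) := by
  obtain ⟨z, rfl⟩ := Subquotient.mk_surjective _ _ x
  rfl

open Classical in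
/-- The map from the direct sum of the persistence modules of the cycles to that of the cactus. -/
def fromCycles (k : Type*) [Field k] (hG : G.IsDirectedCactus) (n : ℕ) (δ : ℝ≥0∞) :
    (⨁ C : G.cycleSubgraphs, (G.restrict C.1).PersistentHomology k n δ) →ₗ[k]
      G.PersistentHomology k n δ :=
  DirectSum.toModule k _ _ (cycleInclusion k hG n δ)

theorem persistenceMap_fromCycles (k : Type*) [Field k] (hG : G.IsDirectedCactus) (n : ℕ)
    {δ δ' : ℝ≥0∞} (h : δ ≤ δ')
    (x : ⨁ C : G.cycleSubgraphs, (G.restrict C.1).PersistentHomology k n δ) :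
    G.persistenceMap k n h (fromCycles k hG n δ x) =
      fromCycles k hG n δ'
        (DirectSum.lmap (fun C : G.cycleSubgraphs => (G.restrict C.1).persistenceMap k n h) x) := by
  classical
  have : (G.persistenceMap k n h).comp (fromCycles k hG n δ) = (fromCycles k hG n δ').comp
      (DirectSum.lmap fun C : G.cycleSubgraphs => (G.restrict C.1).persistenceMap k n h) := by
    refine DirectSum.linearMap_ext k fun C => LinearMap.ext fun x => ?_
    rw [LinearMap.comp_apply, LinearMap.comp_apply, LinearMap.comp_apply, LinearMap.comp_apply,
      DirectSum.lmap_lof, fromCycles, fromCycles, DirectSum.toModule_lof,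
      DirectSum.toModule_lof, persistenceMap_cycleInclusion]
  exact LinearMap.congr_fun this x

open Classical in
theorem fromCycles_sum (k : Type*) [Field k] (hG : G.IsDirectedCactus) (n : ℕ) (δ : ℝ≥0∞)
    [Fintype G.cycleSubgraphs]
    (x : ∀ C : G.cycleSubgraphs, (G.restrict C.1).PersistentHomology k n δ) :
    fromCycles k hG n δ (∑ C, DirectSum.lof k _ _ C (x C)) =
      ∑ C, cycleInclusion k hG n δ C (x C) := by
  rw [map_sum]
  exact Finset.sum_congr rfl fun C _ => by rw [fromCycles, DirectSum.toModule_lof]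

theorem sum_cycleInclusion_mk (k : Type*) [Field k] (hG : G.IsDirectedCactus) (n : ℕ) (δ : ℝ≥0∞)
    [Fintype G.cycleSubgraphs]
    (z : ∀ C : G.cycleSubgraphs, cycles k ((G.restrict C.1).dowker δ) n) :
    ∃ s : cycles k (G.dowker δ) n, (s : Finset V →₀ k) = ∑ C, extend k C.1.verts (z C) ∧
      ∑ C, cycleInclusion k hG n δ C (Subquotient.mk _ _ (z C)) = Subquotient.mk _ _ s := by
  refine ⟨∑ C, ⟨extend k C.1.verts (z C),
    cycles_mono k (induced_le _ _) n (hG.extend_mem_cycles n δ C (z C).2)⟩, ?_, ?_⟩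
  · rw [Submodule.coe_sum]
  · rw [map_sum]
    rfl

variable [Finite V]

theorem fromCycles_bijective (k : Type*) [Field k] (hG : G.IsDirectedCactus) {n : ℕ} {δ : ℝ≥0∞}
    (hδ : n = 0 → G.BridgesWithin δ) : Function.Bijective (fromCycles k hG n δ) := by
  classical
  obtain ⟨H, T, hH, hT, h⟩ := hG.exists_isDecomposedBy k hδ
  have hind : induced (G.dowker δ) H.verts = G.dowker δ := by rw [hH, induced_univ]
  have : Fintype G.cycleSubgraphs := Fintype.ofFinite _
  have hsub (f : G.underlying.Subgraph → Finset V →₀ k) :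
      ∑ C ∈ T, f C = ∑ C : G.cycleSubgraphs, f C.1 := Finset.sum_subtype T hT f
  constructor
  · rw [injective_iff_map_eq_zero]
    intro x hx
    choose z hz using fun C => Subquotient.mk_surjective _ _ (x C)
    have hxsum : x = ∑ C, DirectSum.lof k _ _ C (x C) := (DirectSum.sum_univ_of x).symm
    rw [hxsum, fromCycles_sum] at hx
    simp only [← hz] at hx
    obtain ⟨s, hs, hsum⟩ := sum_cycleInclusion_mk k hG n δ z
    rw [hsum, Subquotient.mk_eq_zero, hs] at hx
    -- `IsDecomposedBy` uses families over all subgraphs; the value 0 off the cycles is never used.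
    let f : G.underlying.Subgraph → Finset V →₀ k := fun C =>
      if hC : C ∈ G.cycleSubgraphs then extend k C.verts (z ⟨C, hC⟩) else 0
    have hf : ∀ C : G.cycleSubgraphs, f C.1 = extend k C.1.verts (z C) := fun C => dif_pos C.2
    have hfT : ∀ C ∈ T, f C ∈ cycles k (induced (G.dowker δ) C.verts) n := fun C hC => by
      rw [hf ⟨C, (hT C).1 hC⟩]
      exact hG.extend_mem_cycles n δ ⟨C, (hT C).1 hC⟩ (z ⟨C, (hT C).1 hC⟩).2
    have hfsum : ∑ C ∈ T, f C = ∑ C : G.cycleSubgraphs, extend k C.1.verts (z C) :=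
      (hsub f).trans (Finset.sum_congr rfl fun C _ => hf C)
    have key := h.mem_boundaries f hfT (by rw [hfsum, hind]; exact hx)
    have hz0 : ∀ C, x C = 0 := fun C => by
      rw [← hz C, Subquotient.mk_eq_zero, ← hG.extend_mem_boundaries_iff n δ C, ← hf C]
      exact key C.1 ((hT C.1).2 C.2)
    rw [hxsum]
    exact Finset.sum_eq_zero fun C _ => by rw [hz0, map_zero]
  · intro y
    obtain ⟨z, rfl⟩ := Subquotient.mk_surjective _ _ y
    obtain ⟨f, hf, hzf⟩ := h.exists_sum z (by rw [hind]; exact z.2)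
    have hw : ∀ C : G.cycleSubgraphs, ∃ w : cycles k ((G.restrict C.1).dowker δ) n,
        extend k C.1.verts w = f C.1 := fun C => by
      have := hf C.1 ((hT C.1).2 C.2)
      rw [← map_extend_cycles (hG.map_mem_dowker_iff C δ) n] at this
      obtain ⟨w, hw, hwf⟩ := this
      exact ⟨⟨w, hw⟩, hwf⟩
    choose w hw using hw
    refine ⟨∑ C, DirectSum.lof k _ _ C (Subquotient.mk _ _ (w C)), ?_⟩
    obtain ⟨s, hs, hsum⟩ := sum_cycleInclusion_mk k hG n δ w
    have hsf : (s : Finset V →₀ k) = ∑ C ∈ T, f C :=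
      hs.trans ((Finset.sum_congr rfl fun C _ => hw C).trans (hsub f).symm)
    rw [fromCycles_sum, hsum, eq_comm, ← sub_eq_zero, ← map_sub, Subquotient.mk_eq_zero,
      Submodule.coe_sub, hsf]
    rwa [hind] at hzf

end Network

end

/-- For a finite directed cactus graph `G`, the `n`-th reduced Dowker homology at `δ` is the direct
sum of those of the cycle subgraphs of `G`, compatibly with the structure maps of the persistence
modules. In degree `0` the scale `δ` has to be one at which the bridges of `G` are present. -/
theorem mainTheorem2 (k : Type*) [Field k] {V : Type*} [Finite V] [LinearOrder V]
    (G : Network V) (hG : G.IsDirectedCactus) (n : ℕ) :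
    ∃ e : ∀ δ : ℝ≥0∞, (n = 0 → G.BridgesWithin δ) →
        (G.PersistentHomology k n δ ≃ₗ[k]
          ⨁ C : G.cycleSubgraphs, (G.restrict C.1).PersistentHomology k n δ),
      ∀ (δ δ' : ℝ≥0∞) (h : δ ≤ δ') (hδ : n = 0 → G.BridgesWithin δ)
        (hδ' : n = 0 → G.BridgesWithin δ') (x : G.PersistentHomology k n δ),
        e δ' hδ' (G.persistenceMap k n h x) =
          DirectSum.lmap (fun C : G.cycleSubgraphs => (G.restrict C.1).persistenceMap k n h)
            (e δ hδ x) := by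
  -- The natural map runs from the cycles to `G`, so `e` is its inverse and naturality is checked on
  -- preimages.
  refine ⟨fun δ hδ => (LinearEquiv.ofBijective _ (Network.fromCycles_bijective k hG hδ)).symm,
    fun δ δ' h hδ hδ' x => ?_⟩
  obtain ⟨y, rfl⟩ :=
    (LinearEquiv.ofBijective _ (Network.fromCycles_bijective k hG hδ)).surjective x
  rw [LinearEquiv.symm_apply_apply, LinearEquiv.symm_apply_eq]
  exact Network.persistenceMap_fromCycles k hG n h y
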